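/- Let $X$ be a non-empty compact metric space, and let $P(X)$ be the space of Borel probability measures on $X$ with the weak topology. For a Hausdorff space $Y$, let $U(Y)$ be the set of non-empty compact subsets of $Y$, partially ordered by reverse inclusion. Let $f=(f_1,\dots,f_n)$ be an iterated function system on $X$, i.e. each $f_i:X\to X$ is a contraction (Lipschitz with some constant $c_i<1$). For a probability vector $p=(p_1,\dots,p_n)$ let $$H_{f,p}:P(X)\to P(X),\qquad H_{f,p}(\mu)=\sum_{i=1}^n p_i\,\mu\circ f_i^{-1}.$$ Given real numbers $p_i^-,p_i^+$ ($1\le i\le n$), let $$K=\Big\{p\in[0,1]^n:\ \sum_{i=1}^n p_i=1\Big\}\cap\prod_{i=1}^n[p_i^-,p_i^+]$$ be the set of admissible weight vectors, with the topology induced from $\mathbb{R}^n$. Then for every $p\in K$ the operator $H_{f,p}$ has a unique fixed point $\operatorname{fix}(H_{f,p})\in P(X)$, and the map $$\operatorname{fix}(H_{f,[-]}):U(K)\to U(P(X)),\qquad A\mapsto\{\operatorname{fix}(H_{f,p}):p\in A\},$$ is well-defined (each of these sets is a non-empty compact subset of $P(X)$) and Scott continuous (it preserves suprema of non-empty directed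 sets; equivalently, it is continuous for the Scott topologies). -/

import Mathlib

open MeasureTheory TopologicalSpace
open scoped ENNReal

/-- The upper space `U(Y)`: the nonempty compact subsets of `Y`, ordered by reverse inclusion. -/
abbrev UpperSpace (Y : Type*) [TopologicalSpace Y] : Type _ := (NonemptyCompacts Y)ᵒᵈ

/-- The underlying subset of `Y` of a point of the upper space `U(Y)`. -/
def UpperSpace.carrier {Y : Type*} [TopologicalSpace Y] (A : UpperSpace Y) : Set Y :=
  ((OrderDual.ofDual A : NonemptyCompacts Y) : Set Y)

theorem UpperSpace.le_iff {Y : Type*} [TopologicalSpace Y] (A B : UpperSpace Y) :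
    A ≤ B ↔ B.carrier ⊆ A.carrier := Iff.rfl

/-- An iterated function system: finitely many contractions `f 0, …, f (n-1)` of a metric space,
each with its own contraction ratio smaller than one. -/
structure IFS (X : Type*) [MetricSpace X] (n : ℕ) where
  map : Fin n → X → X
  contracting : ∀ i, ∃ c, ContractingWith c (map i)

theorem IFS.measurable {X : Type*} [MetricSpace X] [MeasurableSpace X] [BorelSpace X] {n : ℕ}
    (f : IFS X n) (i : Fin n) : Measurable (f.map i) := by
  obtain ⟨c, hc⟩ := f.contracting i
  exact hc.toLipschitzWith.continuous.measurable

/-- The Markov (Hutchinson) operator `H_{f,p}` on Borel probability measures, for a probability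
vector `p`: it sends `μ` to `∑ i, p i • (μ ∘ (f i)⁻¹)`. -/
noncomputable def hutchinson {X : Type*} [MetricSpace X] [MeasurableSpace X] [BorelSpace X] {n : ℕ}
    (f : IFS X n) (p : stdSimplex ℝ (Fin n)) (μ : ProbabilityMeasure X) : ProbabilityMeasure X :=
  ⟨∑ i, ENNReal.ofReal (p.1 i) • (μ : Measure X).map (f.map i), by
    constructor
    have h : ∀ i, ((μ : Measure X).map (f.map i)) Set.univ = 1 := fun i => by
      rw [Measure.map_apply (f.measurable i) MeasurableSet.univ]
      simp
    simp only [Measure.coe_finsetSum, Finset.sum_apply, Measure.smul_apply, h, smul_eq_mul,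
      mul_one]
    have hs : ∑ i, p.1 i = 1 := p.2.2
    have h0 : ∀ i ∈ Finset.univ, 0 ≤ p.1 i := fun i _ => p.2.1 i
    exact (ENNReal.ofReal_sum_of_nonneg h0).symm.trans (by rw [hs, ENNReal.ofReal_one])⟩

/-- The admissible set of weights `K = S ∩ ∏ i, [lo i, hi i]`, with `S` the probability simplex. -/
def admissibleWeights {n : ℕ} (lo hi : Fin n → ℝ) : Set (Fin n → ℝ) :=
  stdSimplex ℝ (Fin n) ∩ Set.univ.pi fun i => Set.Icc (lo i) (hi i)

/-- An admissible weight vector, regarded as a probability vector. -/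
def admissibleWeights.toSimplex {n : ℕ} {lo hi : Fin n → ℝ} (p : admissibleWeights lo hi) :
    stdSimplex ℝ (Fin n) :=
  ⟨p, p.2.1⟩

open Filter Topology
open scoped NNReal

section Hutchinson

variable {X : Type*} [MetricSpace X] {n : ℕ}

theorem IFS.continuous (f : IFS X n) (i : Fin n) : Continuous (f.map i) :=
  (f.contracting i).choose_spec.toLipschitzWith.continuous

/-- Finitely many contractions have a common contraction ratio. -/
theorem IFS.exists_uniform_ratio (f : IFS X n) :
    ∃ c : ℝ≥0, c < 1 ∧ ∀ i, LipschitzWith c (f.map i) := by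
  choose c hc using f.contracting
  refine ⟨Finset.univ.sup c, ?_, fun i => ?_⟩
  · exact (Finset.sup_lt_iff (by simp)).2 fun i _ => (hc i).1
  · exact (hc i).toLipschitzWith.weaken (Finset.le_sup (Finset.mem_univ i))

variable [MeasurableSpace X] [BorelSpace X]

/-- Probability measures are determined by the integrals of bounded Lipschitz functions. -/
theorem ProbabilityMeasure.ext_of_forall_lipschitz_integral_eq {μ ν : ProbabilityMeasure X}
    (h : ∀ (g : X → ℝ) (L : ℝ≥0), LipschitzWith L g → ∫ x, g x ∂μ = ∫ x, g x ∂ν) : μ = ν := by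
  have key : Tendsto (fun _ : ℕ => μ) atTop (𝓝 ν) := by
    rw [tendsto_iff_forall_lipschitz_integral_tendsto]
    rintro g - ⟨L, hL⟩
    rw [h g L hL]
    exact tendsto_const_nhds
  exact tendsto_nhds_unique tendsto_const_nhds key

variable [CompactSpace X]

theorem integrable_of_continuous (μ : ProbabilityMeasure X) {g : X → ℝ} (hg : Continuous g) :
    Integrable g (μ : Measure X) :=
  hg.integrable_of_hasCompactSupport (HasCompactSupport.of_compactSpace g)

/-- The Hutchinson operator is dual to `g ↦ ∑ i, p i • g ∘ f i`. -/
theorem integral_hutchinson (f : IFS X n) (p : stdSimplex ℝ (Fin n)) (μ : ProbabilityMeasure X)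
    {g : X → ℝ} (hg : Continuous g) :
    ∫ x, g x ∂(hutchinson f p μ : Measure X) = ∑ i, p.1 i * ∫ x, g (f.map i x) ∂μ := by
  have hi : ∀ i, Integrable g ((μ : Measure X).map (f.map i)) := fun i =>
    (integrable_map_measure hg.aestronglyMeasurable (f.measurable i).aemeasurable).2
      (integrable_of_continuous μ (hg.comp (f.continuous i)))
  change ∫ x, g x ∂(∑ i, ENNReal.ofReal (p.1 i) • (μ : Measure X).map (f.map i)) = _
  rw [integral_finsetSum_measure fun i _ => (hi i).smul_measure ENNReal.ofReal_ne_top]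
  refine Finset.sum_congr rfl fun i _ => ?_
  rw [integral_smul_measure, ENNReal.toReal_ofReal (p.2.1 i), smul_eq_mul,
    integral_map (f.measurable i).aemeasurable hg.aestronglyMeasurable]

/-- The Hutchinson operator is jointly continuous in the weights and the measure. -/
theorem continuous_hutchinson (f : IFS X n) :
    Continuous fun q : stdSimplex ℝ (Fin n) × ProbabilityMeasure X => hutchinson f q.1 q.2 := by
  rw [ProbabilityMeasure.continuous_iff_forall_continuousMap_continuous_integral]
  intro g
  simp_rw [integral_hutchinson f _ _ g.continuous]
  refine continuous_finsetSum _ fun i _ => Continuous.mul ?_ ?_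
  · exact (continuous_apply i).comp (continuous_subtype_val.comp continuous_fst)
  · exact (ProbabilityMeasure.continuous_integral_continuousMap
      (g.comp ⟨f.map i, f.continuous i⟩)).comp continuous_snd

theorem abs_integral_sub_le_of_lipschitz (μ ν : ProbabilityMeasure X) {g : X → ℝ} {L : ℝ≥0}
    (hg : LipschitzWith L g) :
    |∫ x, g x ∂μ - ∫ x, g x ∂ν| ≤ 2 * L * Metric.diam (Set.univ : Set X) := by
  obtain ⟨x₀⟩ := μ.nonempty
  have bound : ∀ ρ : ProbabilityMeasure X,
      |∫ x, g x ∂ρ - g x₀| ≤ L * Metric.diam (Set.univ : Set X) := fun ρ => by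
    have h := norm_integral_le_of_norm_le_const (μ := (ρ : Measure X))
      (f := fun x => g x - g x₀) (C := L * Metric.diam (Set.univ : Set X))
      (Eventually.of_forall fun x => by
        rw [← dist_eq_norm]
        refine (hg.dist_le_mul x x₀).trans ?_
        gcongr
        exact Metric.dist_le_diam_of_mem isCompact_univ.isBounded trivial trivial)
    rw [integral_sub (integrable_of_continuous ρ hg.continuous) (integrable_const _)] at h
    simpa using h
  have h₁ := abs_le.1 (bound μ)
  have h₂ := abs_le.1 (bound ν)
  rw [abs_le]
  constructor <;> linarith [h₁.1, h₁.2, h₂.1, h₂.2]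

theorem abs_integral_iterate_hutchinson_sub_le (f : IFS X n) (p : stdSimplex ℝ (Fin n)) {c : ℝ≥0}
    (hc : ∀ i, LipschitzWith c (f.map i)) (μ ν : ProbabilityMeasure X) (k : ℕ) {g : X → ℝ}
    {L : ℝ≥0} (hg : LipschitzWith L g) :
    |∫ x, g x ∂((hutchinson f p)^[k] μ : Measure X) -
        ∫ x, g x ∂((hutchinson f p)^[k] ν : Measure X)| ≤
      c ^ k * (2 * L * Metric.diam (Set.univ : Set X)) := by
  induction k generalizing g L with
  | zero => simpa using abs_integral_sub_le_of_lipschitz μ ν hg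
  | succ k ih =>
    rw [Function.iterate_succ_apply', Function.iterate_succ_apply',
      integral_hutchinson f p _ hg.continuous, integral_hutchinson f p _ hg.continuous,
      ← Finset.sum_sub_distrib]
    calc _ ≤ ∑ i, p.1 i * (c ^ k * (2 * (L * c : ℝ≥0) * Metric.diam (Set.univ : Set X))) := by
          refine (Finset.abs_sum_le_sum_abs _ _).trans (Finset.sum_le_sum fun i _ => ?_)
          rw [← mul_sub, abs_mul, abs_of_nonneg (p.2.1 i)]
          exact mul_le_mul_of_nonneg_left (ih (hg.comp (hc i))) (p.2.1 i)
      _ = _ := by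
          rw [← Finset.sum_mul, p.2.2, NNReal.coe_mul]
          ring

theorem tendsto_integral_iterate_hutchinson_sub (f : IFS X n) (p : stdSimplex ℝ (Fin n))
    (μ ν : ProbabilityMeasure X) {g : X → ℝ} {L : ℝ≥0} (hg : LipschitzWith L g) :
    Tendsto (fun k => ∫ x, g x ∂((hutchinson f p)^[k] μ : Measure X) -
      ∫ x, g x ∂((hutchinson f p)^[k] ν : Measure X)) atTop (𝓝 0) := by
  obtain ⟨c, hc, hf⟩ := f.exists_uniform_ratio
  refine squeeze_zero_norm
    (fun k => abs_integral_iterate_hutchinson_sub_le f p hf μ ν k hg) ?_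
  simpa using (tendsto_pow_atTop_nhds_zero_of_lt_one c.2 (by exact_mod_cast hc)).mul_const
    (2 * L * Metric.diam (Set.univ : Set X))

theorem hutchinson_fixedPoint_unique (f : IFS X n) (p : stdSimplex ℝ (Fin n))
    {μ ν : ProbabilityMeasure X} (hμ : hutchinson f p μ = μ) (hν : hutchinson f p ν = ν) :
    μ = ν := by
  refine ProbabilityMeasure.ext_of_forall_lipschitz_integral_eq fun g L hg => ?_
  have h := tendsto_integral_iterate_hutchinson_sub f p μ ν hg
  simp_rw [Function.iterate_fixed hμ, Function.iterate_fixed hν] at h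
  exact sub_eq_zero.1 (tendsto_nhds_unique tendsto_const_nhds h)

theorem exists_hutchinson_fixedPoint [Nonempty X] (f : IFS X n) (p : stdSimplex ℝ (Fin n)) :
    ∃ μ, hutchinson f p μ = μ := by
  obtain ⟨x₀⟩ := ‹Nonempty X›
  set δ : ProbabilityMeasure X := ⟨Measure.dirac x₀, inferInstance⟩
  set U : Ultrafilter (ProbabilityMeasure X) :=
    (hyperfilter ℕ).map fun k => (hutchinson f p)^[k] δ
  obtain ⟨μ, -, hμ⟩ := isCompact_univ.ultrafilter_le_nhds U (by simp)
  have horbit : Tendsto (fun k => (hutchinson f p)^[k] δ) (hyperfilter ℕ) (𝓝 μ) := hμ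
  have hH : Continuous (hutchinson f p) :=
    (continuous_hutchinson f).comp (Continuous.prodMk_right p)
  refine ⟨μ, ProbabilityMeasure.ext_of_forall_lipschitz_integral_eq fun g L hg => ?_⟩
  have hint := ProbabilityMeasure.continuous_integral_continuousMap
    (⟨g, hg.continuous⟩ : C(X, ℝ))
  have h₁ := ((hint.tendsto _).comp ((hH.tendsto μ).comp horbit)).sub
    ((hint.tendsto _).comp horbit)
  have h₂ := (tendsto_integral_iterate_hutchinson_sub f p (hutchinson f p δ) δ hg).mono_left
    Nat.hyperfilter_le_atTop
  refine sub_eq_zero.1 (tendsto_nhds_unique h₁ (h₂.congr fun k => ?_))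
  rw [← Function.iterate_succ_apply, Function.iterate_succ_apply']
  rfl

/-- The fixed point of the Hutchinson operator depends continuously on the weights. -/
theorem continuous_of_hutchinson_fixedPoint (f : IFS X n)
    {fixH : stdSimplex ℝ (Fin n) → ProbabilityMeasure X}
    (h : ∀ p, hutchinson f p (fixH p) = fixH p) : Continuous fixH := by
  refine continuous_iff_ultrafilter.2 fun p U hU => ?_
  obtain ⟨μ, -, hμ⟩ := isCompact_univ.ultrafilter_le_nhds (U.map fixH) (by simp)
  have hfix : Tendsto fixH U (𝓝 μ) := hμ
  have hid : Tendsto id (U : Filter (stdSimplex ℝ (Fin n))) (𝓝 p) := hU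
  have hcomp := ((continuous_hutchinson f).tendsto (p, μ)).comp (hid.prodMk_nhds hfix)
  have hlim : Tendsto fixH U (𝓝 (hutchinson f p μ)) := hcomp.congr h
  have heq : fixH p = μ :=
    hutchinson_fixedPoint_unique f p (h p) (tendsto_nhds_unique hlim hfix)
  rw [heq]
  exact hfix

end Hutchinson

section UpperSpace

variable {Y Z : Type*} [TopologicalSpace Y] [TopologicalSpace Z]

/-- The map `A ↦ φ '' A` of upper spaces induced by a continuous map `φ`. -/
def UpperSpace.map (φ : Y → Z) (hφ : Continuous φ) (A : UpperSpace Y) : UpperSpace Z :=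
  OrderDual.toDual ((OrderDual.ofDual A).map φ hφ)

theorem UpperSpace.isCompact (A : UpperSpace Y) : IsCompact A.carrier :=
  (OrderDual.ofDual A).isCompact

/-- If every member of a directed family in the upper space of a Hausdorff space meets a closed
set `C`, then so does the least upper bound of the family. -/
theorem UpperSpace.inter_nonempty_of_isLUB [T2Space Y] {d : Set (UpperSpace Y)}
    (hd : d.Nonempty) (hdir : DirectedOn (· ≤ ·) d) {a : UpperSpace Y} (ha : IsLUB d a)
    {C : Set Y} (hC : IsClosed C) (h : ∀ A ∈ d, (A.carrier ∩ C).Nonempty) :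
    (a.carrier ∩ C).Nonempty := by
  have : Nonempty d := hd.to_subtype
  have hcompact : ∀ A : d, IsCompact (A.1.carrier ∩ C) := fun A => A.1.isCompact.inter_right hC
  obtain ⟨y, hy⟩ := IsCompact.nonempty_iInter_of_directed_nonempty_isCompact_isClosed
    (fun A : d => A.1.carrier ∩ C)
    (fun A B => by
      obtain ⟨E, hE, hAE, hBE⟩ := hdir A.1 A.2 B.1 B.2
      exact ⟨⟨E, hE⟩, Set.inter_subset_inter_left C hAE, Set.inter_subset_inter_left C hBE⟩)
    (fun A => h A.1 A.2) hcompact (fun A => (hcompact A).isClosed)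
  rw [Set.mem_iInter] at hy
  let s : UpperSpace Y := OrderDual.toDual {y}
  have hs : s ∈ upperBounds d := fun A hA =>
    (UpperSpace.le_iff A s).2 (Set.singleton_subset_iff.2 (hy ⟨A, hA⟩).1)
  exact ⟨y, (UpperSpace.le_iff a s).1 (ha.2 hs) (Set.mem_singleton y), (hy (Classical.arbitrary d)).2⟩

theorem UpperSpace.scottContinuous_map [T2Space Y] [T1Space Z] (φ : Y → Z) (hφ : Continuous φ) :
    ScottContinuous (UpperSpace.map φ hφ) := by
  intro d hd hdir a ha
  refine ⟨?_, fun b hb z hz => ?_⟩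
  · rintro _ ⟨A, hA, rfl⟩
    exact Set.image_mono ((UpperSpace.le_iff A a).1 (ha.1 hA))
  · obtain ⟨y, hy, hyz⟩ := UpperSpace.inter_nonempty_of_isLUB hd hdir ha
      (isClosed_singleton.preimage hφ : IsClosed (φ ⁻¹' {z})) fun A hA => by
        obtain ⟨y, hy, hyz⟩ := (UpperSpace.le_iff _ _).1 (hb ⟨A, hA, rfl⟩) hz
        exact ⟨y, hy, hyz⟩
    exact ⟨y, hy, hyz⟩

end UpperSpace

theorem mainTheorem6 {X : Type*} [MetricSpace X] [CompactSpace X] [Nonempty X]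
    [MeasurableSpace X] [BorelSpace X] {n : ℕ} (f : IFS X n) (lo hi : Fin n → ℝ) :
    ∃ fixH : admissibleWeights lo hi → ProbabilityMeasure X,
      (∀ p μ, hutchinson f (admissibleWeights.toSimplex p) μ = μ ↔ μ = fixH p) ∧
      ∃ F : UpperSpace (admissibleWeights lo hi) → UpperSpace (ProbabilityMeasure X),
        (∀ A, (F A).carrier = {ν | ∃ p ∈ A.carrier, fixH p = ν}) ∧
        ScottContinuous F := by
  choose fixS hfixS using exists_hutchinson_fixedPoint (n := n) f
  have hcont : Continuous fun p : admissibleWeights lo hi =>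
      fixS (admissibleWeights.toSimplex p) :=
    (continuous_of_hutchinson_fixedPoint f hfixS).comp
      (Continuous.subtype_mk continuous_subtype_val _)
  refine ⟨_, fun p μ => ⟨fun h => hutchinson_fixedPoint_unique f _ h (hfixS _), ?_⟩,
    UpperSpace.map _ hcont, fun A => rfl, UpperSpace.scottContinuous_map _ hcont⟩
  rintro rfl
  exact hfixS _
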